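/- Let $\mathcal S_1$ be a semioval in the Desarguesian projective plane $\mathrm{PG}(2,q)$, i.e. a non-empty set of points such that for each $P\in\mathcal S_1$ there is exactly one line $m$ with $\mathcal S_1\cap m=\{P\}$ (the tangent to $\mathcal S_1$ at $P$), and let $\ell$ be a $k$-secant of $\mathcal S_1$, i.e. a line with $|\mathcal S_1\cap\ell|=k$. (1) If $|\mathcal S_1|<q+\frac{3k}{2}-2$, then the $k$ tangents to $\mathcal S_1$ at the points of $\mathcal S_1\cap\ell$ belong to a pencil, i.e. there is a point $G$ lying on all of them. (2) If $|\mathcal S_1|<q+\frac{5k}{3}-3$, then the $k$ tangents to $\mathcal S_1$ at the points of $\mathcal S_1\cap\ell$ either belong to two pencils, i.e. there are two points $G_1\neq G_2$ such that each of these tangents passes through $G_1$ or $G_2$, or they form a dual $k$-arc, i.e. they are $k$ lines no three of which are concurrent. -/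

import Mathlib

open scoped LinearAlgebra.Projectivization

namespace PG2

/-- The points of the projective plane over `F`: one-dimensional subspaces of `F³`. -/
abbrev Point (F : Type*) [Field F] : Type _ := ℙ F (Fin 3 → F)

/-- The lines of the projective plane over `F`, in homogeneous (dual) coordinates. The incidence
`P ∈ m` is Mathlib's (`Configuration.ofField`): the point `(x : y : z)` lies on the line
`[a : b : c]` if and only if `a x + b y + c z = 0`. -/
abbrev Line (F : Type*) [Field F] : Type _ := ℙ F (Fin 3 → F)

variable {F : Type*} [Field F]

/-- The intersection `S ∩ m` of a set of points with (the set of points of) a line. -/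
def inter (S : Set (Point F)) (m : Line F) : Set (Point F) := {P | P ∈ S ∧ P ∈ m}

/-- The line `m` is tangent to `S` at `P`: it meets `S` in exactly the point `P`. -/
def IsTangentAt (S : Set (Point F)) (P : Point F) (m : Line F) : Prop := inter S m = {P}

/-- A semiarc with parameter `t`: a non-empty set of points with exactly `t` tangents at each of
its points. -/
def IsSemiarc (t : ℕ) (S : Set (Point F)) : Prop :=
  S.Nonempty ∧ ∀ P ∈ S, {m : Line F | IsTangentAt S P m}.encard = t

/-- A semioval: exactly one tangent at each point. -/
def IsSemioval (S : Set (Point F)) : Prop := IsSemiarc 1 S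

/-- The line `m` is a `k`-secant of `S`: it meets `S` in exactly `k` points. -/
def IsSecant (k : ℕ) (S : Set (Point F)) (m : Line F) : Prop := (inter S m).encard = k

/-- The set of all tangents to `S` at the points of `S ∩ m`. -/
def tangentsAlong (S : Set (Point F)) (m : Line F) : Set (Line F) :=
  {r | ∃ P ∈ inter S m, IsTangentAt S P r}

/-- The pencil with carrier `G`: all lines through the point `G`. -/
def pencil (G : Point F) : Set (Line F) := {m | G ∈ m}

/-- A dual `k`-arc: a set of `k` lines, no three of which are concurrent. -/
def IsDualArc (k : ℕ) (L : Set (Line F)) : Prop :=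
  L.encard = k ∧
    ∀ a ∈ L, ∀ b ∈ L, ∀ c ∈ L, a ≠ b → a ≠ c → b ≠ c → ¬ ∃ G : Point F, G ∈ a ∧ G ∈ b ∧ G ∈ c

end PG2

/-! Work in the dual plane. Choose `y` on `l` outside `S`; the lines avoiding `y` form an affine
plane in which lines meeting `l` in the same point form a row. The tangents along `l` become a set
`Z` of `k` points in distinct rows. Each of the `n = |S| - k` points of `S` off `l` becomes a line,
and the product `Λ` of these lines vanishes on the row of each `z ∈ Z` exactly outside `z`, because
every other line of that row meets `S` again.

For a curve `H` of degree `d`, put `p(Y) = ∑ x, (Λ * H)(x, Y)`. Since `∑ x, x ^ i = 0` for `i < q -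
1`, the degree of `p` is at most `n + d - (q - 1)`, while `p` takes the value `(Λ * H)(z)` at `z 1`.
So a curve not containing `Z` misses at least `e - d` points of `Z`, where `e = 2k + q - 1 - |S|`
(`spread_of_cover`).

The two hypotheses become `k + 3 ≤ 2e` and `k + 7 ≤ 3e`. The first forces `Z` onto a line
(`Spread.onCurve_one`), that is, the tangents into a pencil. The second forces `Z` onto a conic
(`Spread.onCurve_two`): a line with three points of `Z` splits off, giving two pencils, and
otherwise the tangents form a dual arc. A minimal obstruction to the conic lies on an irreducible
cubic, and is excluded by Bezout's bound and a dimension count for products of evaluation codes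
(`finrank_add_finrank_le_card`). -/

/-! ### Bezout's bound and products of evaluation codes -/

namespace PlaneCurve

open MvPolynomial Module

variable {F : Type*} [Field F]

/-- The polynomials in two variables of total degree at most `d`. -/
noncomputable abbrev P (F : Type*) [Field F] (d : ℕ) : Submodule F (MvPolynomial (Fin 2) F) :=
  restrictTotalDegree (Fin 2) F d

theorem card_exponents (d : ℕ) :
    Nat.card {s : Fin 2 →₀ ℕ | s.degree ≤ d} = (d + 2).choose 2 := by
  have e : {s : Fin 2 →₀ ℕ | s.degree ≤ d} ≃
      (Finset.range (d + 1)).sigma fun i => Finset.range (d + 1 - i) :=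
    { toFun := fun s => ⟨⟨s.1 0, s.1 1⟩, by
        have := s.2
        simp [Finsupp.degree_eq_sum, Fin.sum_univ_two] at this ⊢
        omega⟩
      invFun := fun t => ⟨Finsupp.equivFunOnFinite.symm ![t.1.1, t.1.2], by
        have := Finset.mem_sigma.1 t.2
        simp only [Finset.mem_range] at this
        simp [Finsupp.degree_eq_sum, Fin.sum_univ_two]
        omega⟩
      left_inv := fun s => by
        ext i
        fin_cases i <;> simp
      right_inv := fun t => by
        ext <;> simp }
  rw [Nat.card_congr e, Nat.card_eq_fintype_card, Fintype.card_coe, Finset.card_sigma]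
  simp only [Finset.card_range]
  clear e
  induction d with
  | zero => rfl
  | succ d ih =>
    rw [Finset.sum_range_succ']
    simp only [Nat.add_sub_add_right, Nat.sub_zero]
    rw [ih, Nat.choose_succ_succ' (d + 2) 1, Nat.choose_one_right, add_comm]

theorem finrank_P (d : ℕ) : finrank F (P F d) = (d + 2).choose 2 := by
  rw [← card_exponents d]
  exact finrank_eq_nat_card_basis (basisRestrictSupport F _)

theorem two_mul_choose_two (n : ℕ) : 2 * (n + 2).choose 2 = (n + 2) * (n + 1) := by
  rw [Nat.choose_two_right, Nat.mul_div_cancel' (Nat.even_mul_pred_self _).two_dvd]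
  rfl

theorem finrank_map_mulLeft {h : MvPolynomial (Fin 2) F} (h0 : h ≠ 0) (e : ℕ) :
    finrank F ((P F e).map (LinearMap.mulLeft F h)) = (e + 2).choose 2 := by
  rw [← finrank_P (F := F) e]
  refine (LinearEquiv.finrank_eq (Submodule.equivMapOfInjective _ ?_ _)).symm
  exact fun x y hxy => mul_left_cancel₀ h0 (by simpa using hxy)

/-- Evaluation at the points of a finite set. -/
noncomputable def ev (Z : Finset (Fin 2 → F)) : MvPolynomial (Fin 2) F →ₗ[F] (Z → F) :=
  LinearMap.pi fun z => (aeval (R := F) z.1).toLinearMap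

@[simp] theorem ev_apply (Z : Finset (Fin 2 → F)) (H : MvPolynomial (Fin 2) F) (z : Z) :
    ev Z H z = eval z.1 H := by
  simp [ev, aeval_eq_eval]

theorem exists_ne_zero_vanishing (d : ℕ) (A : Finset (Fin 2 → F))
    (hA : A.card < (d + 2).choose 2) :
    ∃ H : MvPolynomial (Fin 2) F, H ≠ 0 ∧ H.totalDegree ≤ d ∧ ∀ z ∈ A, eval z H = 0 := by
  have h : 0 < finrank F (LinearMap.ker ((ev A).domRestrict (P F d))) := by
    have h1 := LinearMap.finrank_range_add_finrank_ker ((ev A).domRestrict (P F d))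
    have h2 := Submodule.finrank_le (LinearMap.range ((ev A).domRestrict (P F d)))
    rw [finrank_P] at h1
    simp at h2
    omega
  obtain ⟨H, hH, hne⟩ := Submodule.exists_mem_ne_zero_of_ne_bot
    (p := LinearMap.ker ((ev A).domRestrict (P F d)))
    (fun h0 => by rw [h0, finrank_bot] at h; exact absurd h (lt_irrefl 0))
  refine ⟨H, ?_, (mem_restrictTotalDegree _ _ _).1 H.2, fun z hz => ?_⟩
  · intro h0
    exact hne (Subtype.ext h0)
  · have := congrFun (LinearMap.mem_ker.1 hH) ⟨z, hz⟩
    simpa using this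

/-- A polynomial of degree at most `#Z` separating one point of `Z` from all others. -/
theorem exists_separating [DecidableEq F] (Z : Finset (Fin 2 → F)) (z : Fin 2 → F) :
    ∃ H : MvPolynomial (Fin 2) F, H.totalDegree ≤ Z.card ∧ eval z H = 1 ∧
      ∀ w ∈ Z, w ≠ z → eval w H = 0 := by
  have h : ∀ w : Fin 2 → F, ∃ H : MvPolynomial (Fin 2) F, H.totalDegree ≤ 1 ∧
      (w ≠ z → eval z H = 1 ∧ eval w H = 0) := by
    intro w
    by_cases hw : w = z
    · exact ⟨0, by simp, fun h => absurd hw h⟩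
    · obtain ⟨i, hi⟩ := Function.ne_iff.1 hw
      have hi' : z i - w i ≠ 0 := sub_ne_zero.2 (Ne.symm hi)
      refine ⟨C (z i - w i)⁻¹ * (X i - C (w i)), ?_, fun _ => ⟨?_, ?_⟩⟩
      · refine (totalDegree_mul _ _).trans ?_
        rw [totalDegree_C, zero_add]
        refine (totalDegree_sub _ _).trans ?_
        simp
      · simp [hi']
      · simp
  choose H h1 h2 using h
  refine ⟨∏ w ∈ Z.erase z, H w, ?_, ?_, ?_⟩
  · refine (totalDegree_finsetProd _ _).trans ?_
    refine (Finset.sum_le_card_nsmul _ _ 1 fun w _ => h1 w).trans ?_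
    simpa using Finset.card_le_card (Finset.erase_subset z Z)
  · rw [map_prod]
    exact Finset.prod_eq_one fun w hw => (h2 w (Finset.ne_of_mem_erase hw)).1
  · intro w hw hwz
    rw [map_prod]
    exact Finset.prod_eq_zero (Finset.mem_erase.2 ⟨hwz, hw⟩) (h2 w hwz).2

theorem range_ev_eq_top [DecidableEq F] (Z : Finset (Fin 2 → F)) (d : ℕ) (hd : Z.card ≤ d) :
    LinearMap.range ((ev Z).domRestrict (P F d)) = ⊤ := by
  have h : ∀ z : Z, Pi.single z 1 ∈ LinearMap.range ((ev Z).domRestrict (P F d)) := by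
    intro z
    obtain ⟨H, h1, h2, h3⟩ := exists_separating Z z.1
    refine ⟨⟨H, (mem_restrictTotalDegree _ _ _).2 (h1.trans hd)⟩, ?_⟩
    ext w
    by_cases hw : w = z
    · subst hw; simp [h2]
    · simp [hw, h3 w.1 w.2 (fun h => hw (Subtype.ext h))]
  rw [eq_top_iff]
  intro v _
  rw [pi_eq_sum_univ' v]
  refine Submodule.sum_mem _ fun z _ => Submodule.smul_mem _ _ ?_
  convert h z using 1

/-- Bezout's bound for the number of common points of two plane curves, one of them irreducible. -/
theorem card_le_mul_of_prime [DecidableEq F] {f g : MvPolynomial (Fin 2) F} (hf : Prime f)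
    (hg : ¬ f ∣ g) (Z : Finset (Fin 2 → F)) (hfZ : ∀ z ∈ Z, eval z f = 0) (hgZ : ∀ z ∈ Z, eval z g = 0) :
    Z.card ≤ f.totalDegree * g.totalDegree := by
  have hf0 := hf.ne_zero
  have hg0 : g ≠ 0 := fun h => hg (h ▸ dvd_zero f)
  have hfg0 : f * g ≠ 0 := mul_ne_zero hf0 hg0
  obtain ⟨a, ha⟩ : ∃ a, a = f.totalDegree := ⟨_, rfl⟩
  obtain ⟨b, hb⟩ : ∃ b, b = g.totalDegree := ⟨_, rfl⟩
  -- All degrees are raised by `m` so that evaluation on `Z` is surjective in degree `a + b + m`;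
  -- its kernel then has codimension exactly `m`.
  obtain ⟨m, hm⟩ : ∃ m, m = Z.card := ⟨_, rfl⟩
  have hsup := Submodule.finrank_sup_add_finrank_inf_eq
    ((P F (b + m)).map (LinearMap.mulLeft F f)) ((P F (a + m)).map (LinearMap.mulLeft F g))
  rw [finrank_map_mulLeft hf0, finrank_map_mulLeft hg0] at hsup
  have hinf : (P F (b + m)).map (LinearMap.mulLeft F f) ⊓ (P F (a + m)).map (LinearMap.mulLeft F g) ≤
      (P F m).map (LinearMap.mulLeft F (f * g)) := by
    rintro h ⟨⟨u, hu, hu'⟩, ⟨v, hv, hv'⟩⟩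
    simp only [LinearMap.mulLeft_apply] at hu' hv'
    obtain ⟨w, rfl⟩ : f ∣ v := (hf.dvd_or_dvd (hv' ▸ hu' ▸ dvd_mul_right f u)).resolve_left hg
    refine ⟨w, (mem_restrictTotalDegree _ _ _).2 ?_, ?_⟩
    · rcases eq_or_ne w 0 with rfl | hw
      · simp
      · have := (mem_restrictTotalDegree _ _ _).1 hv
        rw [totalDegree_mul_of_isDomain hf0 hw] at this
        omega
    · rw [LinearMap.mulLeft_apply, ← hv']
      ring
  have hinf' := Submodule.finrank_mono hinf
  rw [finrank_map_mulLeft hfg0] at hinf'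
  have hle : (P F (b + m)).map (LinearMap.mulLeft F f) ⊔ (P F (a + m)).map (LinearMap.mulLeft F g) ≤
      (LinearMap.ker ((ev Z).domRestrict (P F (a + b + m)))).map (P F (a + b + m)).subtype := by
    refine sup_le ?_ ?_
    · rintro h ⟨u, hu, rfl⟩
      refine ⟨⟨f * u, (mem_restrictTotalDegree _ _ _).2 ((totalDegree_mul _ _).trans ?_)⟩, ?_, rfl⟩
      · have := (mem_restrictTotalDegree _ _ _).1 hu
        omega
      · simp only [SetLike.mem_coe, LinearMap.mem_ker]
        ext z
        simp [hfZ z.1 z.2]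
    · rintro h ⟨u, hu, rfl⟩
      refine ⟨⟨g * u, (mem_restrictTotalDegree _ _ _).2 ((totalDegree_mul _ _).trans ?_)⟩, ?_, rfl⟩
      · have := (mem_restrictTotalDegree _ _ _).1 hu
        omega
      · simp only [SetLike.mem_coe, LinearMap.mem_ker]
        ext z
        simp [hgZ z.1 z.2]
  have hle' := Submodule.finrank_mono hle
  rw [Submodule.finrank_map_subtype_eq] at hle'
  have hrn := LinearMap.finrank_range_add_finrank_ker ((ev Z).domRestrict (P F (a + b + m)))
  rw [range_ev_eq_top Z _ (by omega), finrank_top, finrank_P, finrank_fintype_fun_eq_card,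
    Fintype.card_coe] at hrn
  -- The four binomials combine, with alternating signs, to exactly `a * b`.
  have h1 := two_mul_choose_two (a + b + m)
  have h2 := two_mul_choose_two (a + m)
  have h3 := two_mul_choose_two (b + m)
  have h4 := two_mul_choose_two m
  rw [← ha, ← hb]
  nlinarith

theorem finrank_map_add_finrank_inf_ker {V W : Type*} [AddCommGroup V] [Module F V]
    [AddCommGroup W] [Module F W] (r : V →ₗ[F] W) (C : Submodule F V)
    [FiniteDimensional F C] :
    finrank F (C.map r) + finrank F (C ⊓ LinearMap.ker r : Submodule F V) = finrank F C := by
  have h := LinearMap.finrank_range_add_finrank_ker (r.domRestrict C)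
  rwa [LinearMap.range_domRestrict, LinearMap.ker_domRestrict, ← Submodule.finrank_map_subtype_eq,
    Submodule.map_comap_subtype] at h

/-- Two spaces of words of which all products lie in a code without words of weight one. -/
theorem finrank_add_finrank_le_card {ι : Type*} [Fintype ι] [DecidableEq ι]
    (E : Submodule F (ι → F))
    (hE : ∀ i, Pi.single i 1 ∉ E) (A : Finset ι) (C D : Submodule F (ι → F))
    (hC : ∀ c ∈ C, ∀ i ∉ A, c i = 0) (hD : ∀ c ∈ D, ∀ i ∉ A, c i = 0)
    (hCD : ∀ c ∈ C, ∀ d ∈ D, c * d ∈ E) : finrank F C + finrank F D ≤ A.card := by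
  classical
  induction A using Finset.strongInduction generalizing C D with
  | H A ih =>
  rcases A.eq_empty_or_nonempty with rfl | ⟨a, ha⟩
  · have h1 : C = ⊥ := (Submodule.eq_bot_iff _).2 fun c hc => funext fun i => hC c hc i (by simp)
    have h2 : D = ⊥ := (Submodule.eq_bot_iff _).2 fun c hc => funext fun i => hD c hc i (by simp)
    simp [h1, h2]
  -- A dual word `w` of `E` with `w a ≠ 0`. On its support `S` in `A` the form `∑ w i * x i * y i`
  -- is nondegenerate and makes the restrictions of `C` and `D` orthogonal, so their dimensions add
  -- up to at most `S.card`. The words vanishing on `S` are left to the induction.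
  obtain ⟨φ, hφa, hφ⟩ := E.exists_le_ker_of_notMem (hE a)
  let w : ι → F := fun i => φ (Pi.single i 1)
  have hw : ∀ v ∈ E, ∑ i, w i * v i = 0 := by
    intro v hv
    have := LinearMap.mem_ker.1 (hφ hv)
    rw [pi_eq_sum_univ' v, map_sum] at this
    rw [← this]
    refine Finset.sum_congr rfl fun i _ => ?_
    rw [map_smul, smul_eq_mul, mul_comm]
  let S := {i ∈ A | w i ≠ 0}
  let r : (ι → F) →ₗ[F] (S → F) := LinearMap.funLeft F F Subtype.val
  let B : LinearMap.BilinForm F (S → F) :=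
    Matrix.toBilin' (Matrix.diagonal fun i : S => w i)
  have hB : B.Nondegenerate := by
    refine LinearMap.BilinForm.nondegenerate_toBilin'_of_det_ne_zero' _ ?_
    rw [Matrix.det_diagonal]
    exact Finset.prod_ne_zero_iff.2 fun i _ => (Finset.mem_filter.1 i.2).2
  have horth : C.map r ≤ B.orthogonal (D.map r) := by
    rintro _ ⟨c, hc, rfl⟩
    rw [LinearMap.BilinForm.mem_orthogonal_iff]
    rintro _ ⟨d, hd, rfl⟩
    rw [Matrix.toBilin'_apply', ← hw _ (hCD c hc d hd)]
    simp only [dotProduct, Matrix.mulVec_diagonal, r, LinearMap.funLeft_apply]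
    rw [Finset.sum_coe_sort S fun i => d i * (w i * c i)]
    refine (Finset.sum_subset (Finset.subset_univ S) fun i _ hi => ?_).trans
      (Finset.sum_congr rfl fun i _ => by rw [Pi.mul_apply]; ring)
    by_cases hiA : i ∈ A
    · have : w i = 0 := by
        by_contra h
        exact hi (Finset.mem_filter.2 ⟨hiA, h⟩)
      simp [this]
    · simp [hC c hc i hiA]
  have h1 := Submodule.finrank_mono horth
  have h2 := LinearMap.BilinForm.finrank_orthogonal hB (D.map r)
  have h2' := Submodule.finrank_le (D.map r)
  rw [finrank_fintype_fun_eq_card, Fintype.card_coe] at h2 h2'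
  have haS : a ∈ S := Finset.mem_filter.2 ⟨ha, hφa⟩
  have hSA : S ⊆ A := Finset.filter_subset _ _
  have hsupp : ∀ c ∈ LinearMap.ker r, ∀ i ∈ S, c i = 0 := fun c hc i hi =>
    congrFun (LinearMap.mem_ker.1 hc) ⟨i, hi⟩
  have h3 := ih (A \ S) (Finset.sdiff_ssubset hSA ⟨a, haS⟩) (C ⊓ LinearMap.ker r)
    (D ⊓ LinearMap.ker r)
    (fun c hc i hi => by
      by_cases hiS : i ∈ S
      · exact hsupp c hc.2 i hiS
      · exact hC c hc.1 i fun hiA => hi (Finset.mem_sdiff.2 ⟨hiA, hiS⟩))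
    (fun c hc i hi => by
      by_cases hiS : i ∈ S
      · exact hsupp c hc.2 i hiS
      · exact hD c hc.1 i fun hiA => hi (Finset.mem_sdiff.2 ⟨hiA, hiS⟩))
    (fun c hc d hd => hCD c hc.1 d hd.1)
  have h4 := finrank_map_add_finrank_inf_ker r C
  have h5 := finrank_map_add_finrank_inf_ker r D
  have h6 := Finset.card_sdiff_add_card_eq_card hSA
  omega

end PlaneCurve

/-! ### Spread sets lie on curves of low degree -/

namespace PlaneCurve

open MvPolynomial Module

variable {F : Type*} [Field F] [DecidableEq F]

/-- The points of `Z` on the curve `H = 0`. -/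
noncomputable def on (Z : Finset (Fin 2 → F)) (H : MvPolynomial (Fin 2) F) : Finset (Fin 2 → F) :=
  {z ∈ Z | eval z H = 0}

/-- The points of `Z` off the curve `H = 0`. -/
noncomputable def off (Z : Finset (Fin 2 → F)) (H : MvPolynomial (Fin 2) F) : Finset (Fin 2 → F) :=
  {z ∈ Z | eval z H ≠ 0}

/-- Each curve of degree `d` that does not contain `Z` misses at least `e - d` points of `Z`. -/
def Spread (e : ℕ) (Z : Finset (Fin 2 → F)) : Prop :=
  ∀ H : MvPolynomial (Fin 2) F, (off Z H).Nonempty → e ≤ H.totalDegree + (off Z H).card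

/-- `Z` lies on a curve of degree at most `d`. -/
def OnCurve (d : ℕ) (Z : Finset (Fin 2 → F)) : Prop :=
  ∃ H : MvPolynomial (Fin 2) F, H ≠ 0 ∧ H.totalDegree ≤ d ∧ ∀ z ∈ Z, eval z H = 0

variable {Z : Finset (Fin 2 → F)} {H G : MvPolynomial (Fin 2) F} {d e : ℕ}

theorem mem_on {z : Fin 2 → F} : z ∈ on Z H ↔ z ∈ Z ∧ eval z H = 0 := Finset.mem_filter

theorem mem_off {z : Fin 2 → F} : z ∈ off Z H ↔ z ∈ Z ∧ eval z H ≠ 0 := Finset.mem_filter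

theorem card_on_add_card_off (Z : Finset (Fin 2 → F)) (H : MvPolynomial (Fin 2) F) :
    (on Z H).card + (off Z H).card = Z.card :=
  Finset.card_filter_add_card_filter_not _

theorem off_nonempty (h : ¬ OnCurve d Z) (H0 : H ≠ 0) (Hd : H.totalDegree ≤ d) :
    (off Z H).Nonempty := by
  by_contra hne
  refine h ⟨H, H0, Hd, fun z hz => ?_⟩
  by_contra hz'
  exact hne ⟨z, mem_off.2 ⟨hz, hz'⟩⟩

theorem Spread.le_add_card_off (hZ : Spread e Z) (h : ¬ OnCurve d Z) (H0 : H ≠ 0)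
    (Hd : H.totalDegree ≤ d) : e ≤ d + (off Z H).card :=
  (hZ H (off_nonempty h H0 Hd)).trans (by omega)

/-- Multiplying a test curve by `H` adds at most `d` to its degree and leaves only the points off
`H` to be missed. This drives the inductions below. -/
theorem Spread.residual (hZ : Spread e Z) (Hd : H.totalDegree ≤ d) : Spread (e - d) (off Z H) := by
  intro G hG
  have h : off Z (H * G) = off (off Z H) G := by
    ext z
    simp [mem_off, and_assoc]
  have h1 := hZ (H * G) (by rwa [h])
  have h2 := totalDegree_mul H G
  rw [h] at h1
  omega

theorem OnCurve.of_off {a b : ℕ} (h : OnCurve a (off Z H)) (H0 : H ≠ 0) (Hd : H.totalDegree ≤ b) :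
    OnCurve (a + b) Z := by
  obtain ⟨G, G0, Gd, hG⟩ := h
  refine ⟨G * H, mul_ne_zero G0 H0, (totalDegree_mul _ _).trans (by omega), fun z hz => ?_⟩
  by_cases hz' : eval z H = 0
  · simp [hz']
  · simp [hG z (mem_off.2 ⟨hz, hz'⟩)]

omit [DecidableEq F] in
theorem OnCurve.mono {a b : ℕ} (h : OnCurve a Z) (hab : a ≤ b) : OnCurve b Z :=
  let ⟨H, H0, Hd, hH⟩ := h
  ⟨H, H0, Hd.trans hab, hH⟩

theorem card_off_le_of_bound {m : ℕ} {Y : Finset (Fin 2 → F)} (hY : Y ⊆ Z)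
    (hm : ∀ H : MvPolynomial (Fin 2) F, H ≠ 0 → H.totalDegree ≤ d → (on Z H).card ≤ m)
    (h : OnCurve d Y) : Y.card ≤ m := by
  obtain ⟨H, H0, Hd, hH⟩ := h
  exact (Finset.card_le_card fun z hz => mem_on.2 ⟨hY hz, hH z hz⟩).trans (hm H H0 Hd)

theorem off_subset : off Z H ⊆ Z := Finset.filter_subset _ _

theorem exists_le_card_on (Z : Finset (Fin 2 → F)) (d m : ℕ) (hm : m ≤ Z.card)
    (hd : m < (d + 2).choose 2) :
    ∃ H : MvPolynomial (Fin 2) F, H ≠ 0 ∧ H.totalDegree ≤ d ∧ m ≤ (on Z H).card := by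
  obtain ⟨A, hA, rfl⟩ := Finset.exists_subset_card_eq hm
  obtain ⟨H, H0, Hd, hH⟩ := exists_ne_zero_vanishing d A hd
  exact ⟨H, H0, Hd, Finset.card_le_card fun z hz => mem_on.2 ⟨hA hz, hH z hz⟩⟩

/-- A curve of degree at most `d` with the maximal number of points of `Z`. -/
theorem exists_max_on (Z : Finset (Fin 2 → F)) (d : ℕ) :
    ∃ H : MvPolynomial (Fin 2) F, (H ≠ 0 ∧ H.totalDegree ≤ d) ∧
      ∀ G : MvPolynomial (Fin 2) F, G ≠ 0 → G.totalDegree ≤ d → (on Z G).card ≤ (on Z H).card := by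
  classical
  let p : ℕ → Prop := fun m => ∃ H : MvPolynomial (Fin 2) F, (H ≠ 0 ∧ H.totalDegree ≤ d) ∧
    (on Z H).card = m
  have hb : ∀ H : MvPolynomial (Fin 2) F, (on Z H).card ≤ Z.card := fun H =>
    Finset.card_le_card (Finset.filter_subset _ _)
  have h1 : p (on Z (1 : MvPolynomial (Fin 2) F)).card := ⟨1, ⟨one_ne_zero, by simp⟩, rfl⟩
  obtain ⟨H, hH, hHm⟩ := Nat.findGreatest_spec (P := p) (hb 1) h1
  refine ⟨H, hH, fun G G0 Gd => ?_⟩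
  rw [hHm]
  exact Nat.le_findGreatest (hb G) ⟨G, ⟨G0, Gd⟩, rfl⟩

/-- Remove a line with the most points, at least two. By induction the rest is collinear, so it is
no larger than what was removed; but it has at least `e - 1` points, whence `2 * (e - 1) ≤ Z.card`.
-/
theorem Spread.onCurve_one (hZ : Spread e Z) (hk : Z.card + 3 ≤ 2 * e) : OnCurve 1 Z := by
  induction hn : Z.card using Nat.strong_induction_on generalizing Z e with
  | _ n ih =>
  subst hn
  by_contra hne
  have hk3 : 3 ≤ Z.card := by
    by_contra h
    obtain ⟨H, H0, Hd, hH⟩ := exists_ne_zero_vanishing 1 Z (by simp [Nat.choose]; omega)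
    exact hne ⟨H, H0, Hd, hH⟩
  obtain ⟨H, ⟨H0, Hd⟩, hmax⟩ := exists_max_on Z 1
  obtain ⟨G, G0, Gd, hG⟩ := exists_le_card_on Z 1 2 (by omega) (by simp [Nat.choose])
  have h2 := hmax G G0 Gd
  have hsum := card_on_add_card_off Z H
  have hoff := hZ.le_add_card_off hne H0 Hd
  have hline := ih _ (by omega) (hZ.residual Hd) (by omega) rfl
  have := card_off_le_of_bound off_subset hmax hline
  omega

omit [DecidableEq F] in
theorem prime_of_forall_factor (H0 : H ≠ 0) (hd : H.totalDegree ≠ 0)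
    (h : ∀ a b, H = a * b → a ≠ 0 → b ≠ 0 → a.totalDegree = 0 ∨ b.totalDegree = 0) : Prime H := by
  have hunit : ∀ a : MvPolynomial (Fin 2) F, a ≠ 0 → a.totalDegree = 0 → IsUnit a := by
    intro a a0 had
    obtain hC := totalDegree_eq_zero_iff_eq_C.1 had
    rw [hC] at a0 ⊢
    exact (IsUnit.mk0 _ fun h => a0 (by rw [h, C_0])).map C
  rw [← UniqueFactorizationMonoid.irreducible_iff_prime, irreducible_iff]
  refine ⟨fun hu => hd ?_, fun a b hab => ?_⟩
  · obtain ⟨c, -, rfl⟩ := MvPolynomial.isUnit_iff_eq_C_of_isReduced.1 hu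
    exact totalDegree_C c
  · have a0 : a ≠ 0 := by rintro rfl; simp [hab] at H0
    have b0 : b ≠ 0 := by rintro rfl; simp [hab] at H0
    exact (h a b hab a0 b0).imp (hunit a a0) (hunit b b0)

omit [DecidableEq F] in
theorem prime_of_totalDegree_eq_one (Hd : H.totalDegree = 1) : Prime H := by
  refine prime_of_forall_factor (by rintro rfl; simp at Hd) (by omega) fun a b hab a0 b0 => ?_
  rw [hab, totalDegree_mul_of_isDomain a0 b0] at Hd
  omega

/-- More than `3 * i` points of an irreducible cubic impose at least `3 * i` conditions on curves
of degree `i`. -/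
theorem three_mul_le_finrank {f : MvPolynomial (Fin 2) F} (hf : Prime f) (hfd : f.totalDegree = 3)
    (hfZ : ∀ z ∈ Z, eval z f = 0) (i : ℕ) (hi : 3 * i < Z.card) :
    3 * i ≤ finrank F ((P F i).map (ev Z)) := by
  have hker : (P F i ⊓ LinearMap.ker (ev Z)) ≤ if i < 3 then ⊥ else
      (P F (i - 3)).map (LinearMap.mulLeft F f) := by
    rintro g ⟨hg, hgZ⟩
    rw [SetLike.mem_coe, mem_restrictTotalDegree] at hg
    have hgZ' : ∀ z ∈ Z, eval z g = 0 := fun z hz => by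
      simpa using congrFun (LinearMap.mem_ker.1 hgZ) ⟨z, hz⟩
    obtain ⟨u, rfl⟩ : f ∣ g := by
      by_contra h
      have := card_le_mul_of_prime hf h Z hfZ hgZ'
      rw [hfd] at this
      omega
    rcases eq_or_ne u 0 with rfl | hu
    · simp
    rw [totalDegree_mul_of_isDomain hf.ne_zero hu, hfd] at hg
    rw [if_neg (by omega)]
    exact ⟨u, (mem_restrictTotalDegree _ _ _).2 (by omega), rfl⟩
  have hrn := finrank_map_add_finrank_inf_ker (ev Z) (P F i)
  rw [finrank_P] at hrn
  have h1 := two_mul_choose_two i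
  split_ifs at hker with h3
  -- For `i < 3` evaluation is injective, with ranks 1, 3, 6; for larger `i` the multiples of `f`
  -- reduce the rank bound to exactly `3 * i`.
  · rw [le_bot_iff.1 hker, finrank_bot] at hrn
    interval_cases i <;> omega
  · obtain ⟨j, rfl⟩ : ∃ j, i = j + 3 := ⟨i - 3, by omega⟩
    have h4 := Submodule.finrank_mono hker
    rw [finrank_map_mulLeft hf.ne_zero, Nat.add_sub_cancel] at h4
    have h2 := two_mul_choose_two j
    nlinarith

/-- In a minimal counterexample lines carry at most 2 points and conics at most 5, since removing a
richer curve leaves a smaller spread set. The same removal puts `Z` on a cubic, irreducible because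
`2 + 5 < 8 ≤ Z.card`. Polynomials of degree `e - 2` give no word of weight one on `Z`, and splitting
`e - 2` into two halves yields `3 * (e - 2) ≤ Z.card`, contrary to `hk`. -/
theorem Spread.onCurve_two (hZ : Spread e Z) (hk : Z.card + 7 ≤ 3 * e) : OnCurve 2 Z := by
  induction hn : Z.card using Nat.strong_induction_on generalizing Z e with
  | _ n ih =>
  subst hn
  by_contra hne
  have hk6 : 6 ≤ Z.card := by
    by_contra h
    obtain ⟨H, H0, Hd, hH⟩ := exists_ne_zero_vanishing 2 Z (by simp [Nat.choose]; omega)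
    exact hne ⟨H, H0, Hd, hH⟩
  have hne1 : ¬ OnCurve 1 Z := fun h => hne (h.mono one_le_two)
  have hcard1 : 2 * e ≤ Z.card + 2 := by
    by_contra h
    exact hne1 (hZ.onCurve_one (by omega))
  have hline : ∀ H : MvPolynomial (Fin 2) F, H ≠ 0 → H.totalDegree ≤ 1 → (on Z H).card ≤ 2 := by
    intro H H0 Hd
    by_contra h
    have hsum := card_on_add_card_off Z H
    obtain ⟨Q, Q0, Qd, hQ⟩ := ih _ (by omega) (hZ.residual Hd) (by omega) rfl
    have hoff := hZ.le_add_card_off hne Q0 Qd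
    -- The points that `Q` misses, at least `e - 2` of them, lie on `H`. So few points are off `H`
    -- that these are collinear, and two lines make a conic.
    have hle : (off Z Q).card ≤ (on Z H).card := Finset.card_le_card fun z hz => by
      obtain ⟨hz1, hz2⟩ := mem_off.1 hz
      refine mem_on.2 ⟨hz1, ?_⟩
      by_contra hz3
      exact hz2 (hQ z (mem_off.2 ⟨hz1, hz3⟩))
    exact hne (((hZ.residual Hd).onCurve_one (by omega)).of_off H0 Hd)
  have hconic : ∀ H : MvPolynomial (Fin 2) F, H ≠ 0 → H.totalDegree ≤ 2 → (on Z H).card ≤ 5 := by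
    obtain ⟨Q, ⟨Q0, Qd⟩, hmax⟩ := exists_max_on Z 2
    refine fun H H0 Hd => (hmax H H0 Hd).trans ?_
    by_contra h
    have hsum := card_on_add_card_off Z Q
    have h1 := card_off_le_of_bound off_subset hmax
      (ih _ (by omega) (hZ.residual Qd) (by omega) rfl)
    have h2 := hZ.le_add_card_off hne Q0 Qd
    have h3 := card_off_le_of_bound off_subset hline ((hZ.residual Qd).onCurve_one (by omega))
    omega
  have hk8 : 8 ≤ Z.card := by
    obtain ⟨Q, Q0, Qd, hQ⟩ := exists_le_card_on Z 2 5 (by omega) (by simp [Nat.choose])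
    have hsum := card_on_add_card_off Z Q
    have h2 := hZ.le_add_card_off hne Q0 Qd
    omega
  obtain ⟨f, f0, fd, hf⟩ : OnCurve 3 Z := by
    by_cases h9 : Z.card ≤ 9
    · exact exists_ne_zero_vanishing 3 Z (by simp [Nat.choose]; omega)
    by_contra hne3
    obtain ⟨f, f0, fd, hf⟩ := exists_le_card_on Z 3 9 (by omega) (by simp [Nat.choose])
    have hsum := card_on_add_card_off Z f
    have h1 := card_off_le_of_bound off_subset hconic
      (ih _ (by omega) (hZ.residual fd) (by omega) rfl)
    have h2 := hZ.le_add_card_off hne3 f0 fd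
    have h3 := card_off_le_of_bound off_subset hline ((hZ.residual fd).onCurve_one (by omega))
    omega
  have hfd : f.totalDegree = 3 := by
    by_contra h
    exact hne ⟨f, f0, by omega, hf⟩
  have hprime : Prime f := by
    refine prime_of_forall_factor f0 (by omega) fun a b hab a0 b0 => ?_
    by_contra! hdeg
    have hle : Z.card ≤ (on Z a).card + (on Z b).card := by
      refine (Finset.card_le_card fun z hz => ?_).trans (Finset.card_union_le _ _)
      have := hf z hz
      rw [hab, map_mul, mul_eq_zero] at this
      exact Finset.mem_union.2 (this.imp (fun h => mem_on.2 ⟨hz, h⟩) fun h => mem_on.2 ⟨hz, h⟩)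
    rw [hab, totalDegree_mul_of_isDomain a0 b0] at hfd
    rcases le_or_gt a.totalDegree 1 with h | h
    · have h1 := hline a a0 h
      have h2 := hconic b b0 (by omega)
      omega
    · have h1 := hconic a a0 (by omega)
      have h2 := hline b b0 (by omega)
      omega
  -- Both halves satisfy `3 * i < Z.card` because `2 * e ≤ Z.card + 2`.
  have h1 := three_mul_le_finrank hprime hfd hf ((e - 2) / 2) (by omega)
  have h2 := three_mul_le_finrank hprime hfd hf (e - 2 - (e - 2) / 2) (by omega)
  have h3 := finrank_add_finrank_le_card ((P F (e - 2)).map (ev Z)) (by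
      rintro z ⟨G, hG, hGz⟩
      have hoff : off Z G = {z.1} := by
        ext w
        rw [mem_off, Finset.mem_singleton]
        constructor
        · rintro ⟨hw, hw'⟩
          by_contra hwz
          refine hw' ?_
          rw [← ev_apply Z G ⟨w, hw⟩, hGz]
          exact Pi.single_eq_of_ne (fun h => hwz (congrArg Subtype.val h)) _
        · rintro rfl
          refine ⟨z.2, ?_⟩
          rw [← ev_apply Z G z, hGz]
          simp
      have h1 := hZ G (by rw [hoff]; exact Finset.singleton_nonempty _)
      rw [hoff, Finset.card_singleton] at h1
      have h2 := (mem_restrictTotalDegree _ _ _).1 hG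
      omega) Finset.univ ((P F ((e - 2) / 2)).map (ev Z)) ((P F (e - 2 - (e - 2) / 2)).map (ev Z))
    (by simp) (by simp) (by
      rintro _ ⟨G, hG, rfl⟩ _ ⟨H, hH, rfl⟩
      refine ⟨G * H, (mem_restrictTotalDegree _ _ _).2 ((totalDegree_mul _ _).trans ?_), ?_⟩
      · have h1 := (mem_restrictTotalDegree _ _ _).1 hG
        have h2 := (mem_restrictTotalDegree _ _ _).1 hH
        omega
      · ext z
        simp)
  rw [Finset.card_univ, Fintype.card_coe] at h3
  omega

/-- Lines with more than two points of a set on a conic are components of the conic. -/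
theorem OnCurve.two_lines (h : OnCurve 2 Z) (H0 : H ≠ 0) (Hd : H.totalDegree ≤ 1)
    (h3 : 3 ≤ (on Z H).card) : OnCurve 1 (off Z H) := by
  obtain ⟨Q, Q0, Qd, hQ⟩ := h
  have Hd1 : H.totalDegree = 1 := by
    refine le_antisymm Hd (Nat.one_le_iff_ne_zero.2 fun hd => ?_)
    rw [totalDegree_eq_zero_iff_eq_C] at hd
    obtain ⟨z, hz⟩ := Finset.card_pos.1 (show 0 < (on Z H).card by omega)
    have := (mem_on.1 hz).2
    rw [hd, eval_C] at this
    exact H0 (by rw [hd, this, C_0])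
  -- Otherwise Bezout would allow only two common points.
  obtain ⟨G, rfl⟩ : H ∣ Q := by
    by_contra hdvd
    have := card_le_mul_of_prime (prime_of_totalDegree_eq_one Hd1) hdvd (on Z H)
      (fun z hz => (mem_on.1 hz).2) fun z hz => hQ z (mem_on.1 hz).1
    rw [Hd1, one_mul] at this
    omega
  have G0 : G ≠ 0 := right_ne_zero_of_mul Q0
  rw [totalDegree_mul_of_isDomain H0 G0, Hd1] at Qd
  refine ⟨G, G0, by omega, fun z hz => ?_⟩
  obtain ⟨hz1, hz2⟩ := mem_off.1 hz
  have := hQ z hz1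
  rw [map_mul] at this
  exact (mul_eq_zero.1 this).resolve_left hz2

end PlaneCurve

/-! ### Spreadness from power sums over the rows -/

namespace PlaneCurve

open MvPolynomial Module

variable {F : Type*} [Field F] [DecidableEq F]

/-- Let `Λ` be a curve of degree at most `n` that covers, in each row `z 1` of a point `z ∈ Z`, all
points but `z`. Then `Z` is spread. -/
theorem spread_of_cover [Fintype F] (Z : Finset (Fin 2 → F))
    (hZ : Set.InjOn (fun z => z 1) (Z : Set (Fin 2 → F)))
    (n : ℕ) (Λ : MvPolynomial (Fin 2) F) (hn : Λ.totalDegree ≤ n)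
    (hΛ : ∀ z ∈ Z, ∀ x, eval ![x, z 1] Λ ≠ 0 ↔ x = z 0) :
    Spread (Z.card + (Fintype.card F - 1) - n) Z := by
  intro H hH
  have hsum := card_on_add_card_off Z H
  suffices h : (on Z H).card + (Fintype.card F - 1) ≤ n + H.totalDegree by omega
  let u := Λ * H
  have hu : u.totalDegree ≤ n + H.totalDegree := (totalDegree_mul _ _).trans (by omega)
  -- In the row of `z ∈ Z` only the term `x = z 0` survives.
  let p : Polynomial F := ∑ x : F, aeval ![Polynomial.C x, Polynomial.X] u
  have heval : ∀ z ∈ Z, p.eval (z 1) = eval z u := by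
    intro z hz
    have h1 : ∀ x, (aeval ![Polynomial.C x, Polynomial.X] u : Polynomial F).eval (z 1) =
        eval ![x, z 1] u := by
      intro x
      rw [← Polynomial.coe_evalRingHom, map_aeval]
      refine congrArg₂ (fun f g => eval₂Hom f g u) (RingHom.ext fun a => by simp)
        (funext fun i => ?_)
      fin_cases i <;> simp
    rw [Polynomial.eval_finsetSum, Finset.sum_congr rfl fun x _ => h1 x,
      Finset.sum_eq_single (z 0)]
    · congr 2
      ext i
      fin_cases i <;> rfl
    · intro x _ hx
      have : eval ![x, z 1] Λ = 0 := by
        by_contra h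
        exact hx ((hΛ z hz x).1 h)
      simp [u, this]
    · simp
  have hΛz : ∀ z ∈ Z, eval z Λ ≠ 0 := by
    intro z hz
    have h := (hΛ z hz (z 0)).2 rfl
    rwa [show ![z 0, z 1] = z by ext i; fin_cases i <;> rfl] at h
  have hp : p ≠ 0 := by
    obtain ⟨z, hz⟩ := hH
    obtain ⟨hz1, hz2⟩ := mem_off.1 hz
    intro h0
    have := heval z hz1
    rw [h0, Polynomial.eval_zero, map_mul] at this
    exact mul_ne_zero (hΛz z hz1) hz2 this.symm
  have hdeg : p.natDegree + (Fintype.card F - 1) ≤ n + H.totalDegree := by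
    have hlead : p.coeff p.natDegree ≠ 0 := by simpa using hp
    have hx : ∀ x : F, (aeval ![Polynomial.C x, Polynomial.X] u : Polynomial F).coeff p.natDegree =
        ∑ m ∈ u.support, if p.natDegree = m 1 then u.coeff m * x ^ m 0 else 0 := by
      intro x
      rw [aeval_def, eval₂_eq', Polynomial.finsetSum_coeff]
      refine Finset.sum_congr rfl fun m _ => ?_
      rw [Fin.prod_univ_two]
      simp only [Polynomial.algebraMap_eq, Matrix.cons_val_zero, Matrix.cons_val_one,
        ← Polynomial.C_pow, Polynomial.coeff_C_mul, Polynomial.coeff_X_pow]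
      split_ifs <;> simp
    rw [Polynomial.finsetSum_coeff, Finset.sum_congr rfl fun x _ => hx x,
      Finset.sum_comm] at hlead
    obtain ⟨m, hm, hne⟩ := Finset.exists_ne_zero_of_sum_ne_zero hlead
    split_ifs at hne with hm1
    · rw [← Finset.mul_sum] at hne
      -- A monomial contributing to the leading coefficient has a nonzero power sum in `x`, so it
      -- spends at least `q - 1` of its degree on the first variable.
      have h0 : Fintype.card F - 1 ≤ m 0 := by
        by_contra h
        exact hne (by rw [FiniteField.sum_pow_lt_card_sub_one F _ (by omega), mul_zero])
      have h2 := (le_totalDegree hm).trans hu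
      rw [Finsupp.sum_fintype _ _ (fun _ => rfl), Fin.sum_univ_two] at h2
      omega
    · simp at hne
  have hroots : (on Z H).card ≤ p.natDegree := by
    rw [← Finset.card_image_of_injOn (f := fun z : Fin 2 → F => z 1) (s := on Z H)
      (hZ.mono fun z hz => (mem_on.1 hz).1)]
    refine (Finset.card_le_card (t := p.roots.toFinset) ?_).trans
      ((Multiset.toFinset_card_le _).trans (Polynomial.card_roots' p))
    intro s hs
    obtain ⟨z, hz, rfl⟩ := Finset.mem_image.1 hs
    obtain ⟨hz1, hz2⟩ := mem_on.1 hz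
    rw [Multiset.mem_toFinset, Polynomial.mem_roots hp, Polynomial.IsRoot, heval z hz1, map_mul,
      hz2, mul_zero]
  omega

end PlaneCurve

/-! ### An affine chart of the dual plane -/

namespace PG2

open MvPolynomial Module Projectivization Configuration

variable {F : Type*} [Field F]

theorem totalDegree_affine_le (α β γ : F) :
    (C α * X 0 + C β * X 1 + C γ : MvPolynomial (Fin 2) F).totalDegree ≤ 1 := by
  have h : ∀ (a : F) (i : Fin 2), (C a * X i : MvPolynomial (Fin 2) F).totalDegree ≤ 1 :=
    fun a i => (totalDegree_mul _ _).trans (by rw [totalDegree_C, totalDegree_X])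
  refine (totalDegree_add _ _).trans (max_le ((totalDegree_add _ _).trans
    (max_le (h _ _) (h _ _))) ?_)
  rw [totalDegree_C]
  exact zero_le_one

/-- `L` and `b` span the lines through `y`, and `c` normalises the others; the cross product of `y`
with some `v` satisfying `L ⬝ᵥ v = 1` serves as `b`. -/
theorem exists_frame (y L : Fin 3 → F) (hy : y ≠ 0) (hL : L ≠ 0) (hyL : y ⬝ᵥ L = 0) :
    ∃ b c : Fin 3 → F, y ⬝ᵥ b = 0 ∧ y ⬝ᵥ c = 1 ∧ LinearIndependent F ![L, b, c] := by
  have hdual : ∀ w : Fin 3 → F, w ≠ 0 → ∃ v : Fin 3 → F, w ⬝ᵥ v = 1 := by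
    intro w hw
    obtain ⟨i, hi⟩ := Function.ne_iff.1 hw
    exact ⟨Pi.single i (w i)⁻¹, by simpa using mul_inv_cancel₀ hi⟩
  obtain ⟨v, hv⟩ := hdual L hL
  obtain ⟨c, hc⟩ := hdual y hy
  have hb : crossProduct y v ≠ 0 := by
    intro h
    have := cross_cross_eq_smul_sub_smul y v L
    rw [h, hyL, dotProduct_comm v, hv] at this
    simp at this
    exact hy this
  refine ⟨crossProduct y v, c, dot_self_cross y v, hc, ?_⟩
  rw [Fintype.linearIndependent_iff]
  intro g hg
  simp only [Fin.sum_univ_three, Matrix.cons_val] at hg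
  have h2 : g 2 = 0 := by
    have := congrArg (y ⬝ᵥ ·) hg
    simpa [dotProduct_add, hyL, dot_self_cross, hc] using this
  have h0 : g 0 = 0 := by
    have := congrArg (v ⬝ᵥ ·) hg
    simpa [dotProduct_add, h2, dot_cross_self, dotProduct_comm v L, hv] using this
  have h1 : g 1 = 0 := by
    simpa [h0, h2, hb] using hg
  intro i
  fin_cases i <;> assumption

set_option maxHeartbeats 1000000 in
/-- Affine coordinates for the lines not through a point `y` of the line `l`. -/
theorem exists_chart (l : Line F) (y : Point F) (hy : y ∈ l) :
    ∃ M : (Fin 2 → F) → Line F, (∀ z, y ∉ M z) ∧ (∀ m : Line F, y ∉ m → ∃ z, M z = m) ∧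
      Function.Injective M ∧
      (∀ P : Point F, P ∈ l → ∀ z x, P ∈ M z → P ∈ M ![x, z 1]) ∧
      (∀ P : Point F, ∃ H : MvPolynomial (Fin 2) F, H ≠ 0 ∧ H.totalDegree ≤ 1 ∧
        ∀ z, eval z H = 0 ↔ P ∈ M z) ∧
      (∀ H : MvPolynomial (Fin 2) F, H ≠ 0 → H.totalDegree ≤ 1 →
        ∃ P : Point F, ∀ z, eval z H = 0 ↔ P ∈ M z) := by
  induction y using Projectivization.ind with | h y hy0 =>
  induction l using Projectivization.ind with | h L hL0 =>
  rw [ofField.mem_iff, orthogonal_mk hy0 hL0] at hy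
  obtain ⟨b, c, hb, hc, hlin⟩ := exists_frame y L hy0 hL0 hy
  have hspan : Submodule.span F (Set.range ![L, b, c]) = ⊤ :=
    hlin.span_eq_top_of_card_eq_finrank (by simp)
  -- Changing `z 0` adds a multiple of `L`, which does not affect incidence with points of `l`: this
  -- makes the rows.
  let V : (Fin 2 → F) → Fin 3 → F := fun z => z 0 • L + z 1 • b + c
  have hyV : ∀ z, y ⬝ᵥ V z = 1 := fun z => by simp [V, dotProduct_add, hy, hb, hc]
  have hV0 : ∀ z, V z ≠ 0 := fun z h => by
    have := hyV z
    simp [h] at this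
  let Φ : (Fin 3 → F) →ₗ[F] MvPolynomial (Fin 2) F :=
    { toFun := fun G => C (G ⬝ᵥ L) * X 0 + C (G ⬝ᵥ b) * X 1 + C (G ⬝ᵥ c)
      map_add' := fun G G' => by simp only [add_dotProduct, C_add]; ring
      map_smul' := fun t G => by
        simp only [smul_dotProduct, smul_eq_mul, C_mul, smul_eq_C_mul, RingHom.id_apply]; ring }
  have hΦ : ∀ G z, eval z (Φ G) = G ⬝ᵥ V z := fun G z => by
    simp [Φ, V, dotProduct_add, mul_comm]
  have hinj : Function.Injective Φ := by
    rw [← LinearMap.ker_eq_bot, LinearMap.ker_eq_bot']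
    intro G hG
    have h : ∀ z, G ⬝ᵥ V z = 0 := fun z => by rw [← hΦ, hG, map_zero]
    have h1 : G ⬝ᵥ c = 0 := by simpa [V] using h 0
    have h2 : G ⬝ᵥ L = 0 := by simpa [V, dotProduct_add, h1] using h ![1, 0]
    have h3 : G ⬝ᵥ b = 0 := by simpa [V, dotProduct_add, h1] using h ![0, 1]
    refine dotProduct_eq_zero G fun w => ?_
    have hw : w ∈ Submodule.span F (Set.range ![L, b, c]) := hspan ▸ Submodule.mem_top
    induction hw using Submodule.span_induction with
    | mem x hx =>
      obtain ⟨i, rfl⟩ := hx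
      fin_cases i <;> assumption
    | zero => simp
    | add x y _ _ hx hy => rw [dotProduct_add, hx, hy, add_zero]
    | smul a x _ hx => rw [dotProduct_smul, hx, smul_zero]
  have hdeg : ∀ G, (Φ G).totalDegree ≤ 1 := by
    intro G
    exact totalDegree_affine_le _ _ _
  -- Nonzero constants are included: they come from the point `y`, which lies on no line of the
  -- chart.
  have hrange : LinearMap.range Φ = PlaneCurve.P F 1 := by
    refine Submodule.eq_of_le_of_finrank_eq ?_ ?_
    · rintro _ ⟨G, rfl⟩
      exact (mem_restrictTotalDegree _ _ _).2 (hdeg G)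
    · rw [LinearMap.finrank_range_of_inj hinj, PlaneCurve.finrank_P]
      simp [Nat.choose]
  refine ⟨fun z => mk F (V z) (hV0 z), fun z => ?_, fun m hm => ?_, fun z z' h => ?_,
    fun P hP z x hPz => ?_, fun P => ?_, fun H H0 Hd => ?_⟩
  · rw [ofField.mem_iff, orthogonal_mk hy0 (hV0 z), hyV]
    exact one_ne_zero
  · induction m using Projectivization.ind with | h m hm0 =>
    rw [ofField.mem_iff, orthogonal_mk hy0 hm0] at hm
    have hmem : m ∈ Submodule.span F (Set.range ![L, b, c]) := hspan ▸ Submodule.mem_top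
    obtain ⟨g, rfl⟩ := (Submodule.mem_span_range_iff_exists_fun F).1 hmem
    simp only [Fin.sum_univ_three, Matrix.cons_val] at hm ⊢
    have h2 : g 2 ≠ 0 := by
      simpa [dotProduct_add, hy, hb, hc] using hm
    refine ⟨![g 0 / g 2, g 1 / g 2], ?_⟩
    rw [mk_eq_mk_iff']
    refine ⟨(g 2)⁻¹, ?_⟩
    simp [V, smul_add, smul_smul, h2, div_eq_inv_mul]
  · obtain ⟨a, ha⟩ := (mk_eq_mk_iff' F _ _ _ _).1 h
    have ha1 : a = 1 := by
      have := congrArg (y ⬝ᵥ ·) ha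
      simpa [hyV] using this
    rw [ha1, one_smul] at ha
    have := (Fintype.linearIndependent_iff.1 hlin) ![z 0 - z' 0, z 1 - z' 1, 0] (by
      simp only [Fin.sum_univ_three, Matrix.cons_val]
      have h' : V z - V z' = 0 := by rw [ha, sub_self]
      rw [← h']
      simp only [V]
      module)
    ext i
    fin_cases i
    · exact sub_eq_zero.1 (this 0)
    · exact sub_eq_zero.1 (this 1)
  · induction P using Projectivization.ind with | h P hP0 =>
    rw [ofField.mem_iff, orthogonal_mk] at *
    simp [V, dotProduct_add, hP] at hPz ⊢
    exact hPz
  · induction P using Projectivization.ind with | h P hP0 =>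
    refine ⟨Φ P, fun h => hP0 (hinj (h.trans (map_zero Φ).symm)), hdeg P, fun z => ?_⟩
    rw [hΦ, ofField.mem_iff, orthogonal_mk]
  · obtain ⟨G, rfl⟩ : H ∈ LinearMap.range Φ := hrange ▸ (mem_restrictTotalDegree _ _ _).2 Hd
    have hG0 : G ≠ 0 := by
      rintro rfl
      exact H0 (map_zero Φ)
    refine ⟨mk F G hG0, fun z => ?_⟩
    rw [hΦ, ofField.mem_iff, orthogonal_mk]

end PG2

/-! ### Tangents to a semioval as a spread set -/

namespace PG2

open MvPolynomial Module Projectivization Configuration PlaneCurve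

variable {F : Type*} [Field F]

theorem eq_or_eq {P Q : Point F} {l m : Line F} (h1 : P ∈ l) (h2 : Q ∈ l) (h3 : P ∈ m)
    (h4 : Q ∈ m) : P = Q ∨ l = m :=
  Nondegenerate.eq_or_eq h1 h2 h3 h4

theorem exists_ne_point (G : Point F) : ∃ G' : Point F, G ≠ G' := by
  by_contra! h
  have h1 : (![1, 0, 0] : Fin 3 → F) ≠ 0 := fun h => one_ne_zero (congrFun h 0)
  have h2 : (![0, 1, 0] : Fin 3 → F) ≠ 0 := fun h => one_ne_zero (congrFun h 1)
  obtain ⟨a, ha⟩ := (mk_eq_mk_iff' F _ _ h1 h2).1 ((h _).symm.trans (h _))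
  simpa using congrFun ha 0

theorem exists_mem_mem (l m : Line F) : ∃ P : Point F, P ∈ l ∧ P ∈ m := by
  classical
  by_cases h : l = m
  · obtain ⟨n, hn⟩ := exists_ne_point l
    exact ⟨HasPoints.mkPoint hn, (HasPoints.mkPoint_ax hn).1, h ▸ (HasPoints.mkPoint_ax hn).1⟩
  · exact ⟨HasPoints.mkPoint h, HasPoints.mkPoint_ax h⟩

theorem exists_two_lines [Finite F] (P : Point F) (l : Line F) :
    ∃ a b : Line F, P ∈ a ∧ P ∈ b ∧ a ≠ b ∧ a ≠ l ∧ b ≠ l := by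
  classical
  have h := ProjectivePlane.two_lt_lineCount (L := Line F) P
  have h2 : 2 < ({m : Line F | P ∈ m} : Set (Line F)).ncard := h
  have h3 : 1 < ({m : Line F | P ∈ m} \ {l} : Set (Line F)).ncard := by
    have := Set.pred_ncard_le_ncard_sdiff_singleton {m : Line F | P ∈ m} l
    omega
  obtain ⟨a, ha, b, hb, hab⟩ := (Set.one_lt_ncard).1 h3
  exact ⟨a, b, ha.1, hb.1, hab, ha.2, hb.2⟩

theorem IsSemioval.exists_tangent {S : Set (Point F)} (hS : IsSemioval S) {P : Point F}
    (hP : P ∈ S) : ∃ r, ∀ m, IsTangentAt S P m ↔ m = r := by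
  obtain ⟨r, hr⟩ := Set.encard_eq_one.1 ((hS.2 P hP).trans Nat.cast_one)
  exact ⟨r, fun m => Set.ext_iff.1 hr m⟩

/-- A line with at least two points of a semioval is not contained in the semioval. -/
theorem IsSemioval.exists_notMem [Finite F] {S : Set (Point F)} (hS : IsSemioval S) {l : Line F}
    {A : Point F} (hA : A ∈ inter S l) : ∃ y : Point F, y ∈ l ∧ y ∉ S := by
  by_contra! hl
  -- The tangent at a point off `l` would meet `l` in a second point of `S`. So `S` is contained in
  -- `l`, and every other line through `A` is tangent there.
  have hSl : ∀ Q ∈ S, Q ∈ l := by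
    intro Q hQ
    by_contra hQl
    obtain ⟨r, hr⟩ := hS.exists_tangent hQ
    have hr' : inter S r = {Q} := (hr r).2 rfl
    obtain ⟨R, hRr, hRl⟩ := exists_mem_mem r l
    have : R ∈ inter S r := ⟨hl R hRl, hRr⟩
    rw [hr', Set.mem_singleton_iff] at this
    exact hQl (this ▸ hRl)
  obtain ⟨a, b, ha, hb, hab, hal, hbl⟩ := exists_two_lines A l
  have htan : ∀ m : Line F, A ∈ m → m ≠ l → IsTangentAt S A m := by
    intro m hm hml
    ext Q
    refine ⟨fun hQ => ?_, fun hQ => ?_⟩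
    · exact (eq_or_eq hQ.2 hm (hSl Q hQ.1) hA.2).resolve_right hml
    · rw [Set.mem_singleton_iff.1 hQ]
      exact ⟨hA.1, hm⟩
  obtain ⟨r, hr⟩ := hS.exists_tangent hA.1
  exact hab (((hr a).1 (htan a ha hal)).trans ((hr b).1 (htan b hb hbl)).symm)

/-- The tangents to a semioval at the points of a `k`-secant with `k ≥ 2`, in an affine chart of
the dual plane. -/
theorem exists_spread_tangents [Fintype F] [DecidableEq F] {S : Set (Point F)}
    (hS : IsSemioval S) {k : ℕ} {l : Line F} (hl : IsSecant k S l) (hk : 2 ≤ k) :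
    ∃ (M : (Fin 2 → F) → Line F) (Z : Finset (Fin 2 → F)),
      Function.Injective M ∧ Z.card = k ∧ M '' Z = tangentsAlong S l ∧
      Spread (k + (Fintype.card F - 1) - (S.ncard - k)) Z ∧
      (∀ P : Point F, ∃ H : MvPolynomial (Fin 2) F, H ≠ 0 ∧ H.totalDegree ≤ 1 ∧
        ∀ z, eval z H = 0 ↔ P ∈ M z) ∧
      (∀ H : MvPolynomial (Fin 2) F, H ≠ 0 → H.totalDegree ≤ 1 →
        ∃ P : Point F, ∀ z, eval z H = 0 ↔ P ∈ M z) := by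
  classical
  have hncard : (inter S l).ncard = k := by
    rw [Set.ncard_def, hl]
    rfl
  obtain ⟨A, hA⟩ : (inter S l).Nonempty := Set.nonempty_of_ncard_ne_zero (by omega)
  obtain ⟨y, hyl, hyS⟩ := hS.exists_notMem hA
  obtain ⟨M, hyM, hMsurj, hMinj, hMrow, hMpt, hMline⟩ := exists_chart l y hyl
  have hT : ∀ P : inter S l, ∃ z, ∀ m, IsTangentAt S P.1 m ↔ m = M z := by
    rintro ⟨P, hPS, hPl⟩
    obtain ⟨r, hr⟩ := hS.exists_tangent hPS
    have hrP : inter S r = {P} := (hr r).2 rfl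
    have hPr : P ∈ r := (hrP ▸ Set.mem_singleton P : P ∈ inter S r).2
    -- A tangent through `y` would be `l` itself, which has `k ≥ 2` points of `S`.
    have hyr : y ∉ r := by
      intro hyr
      rcases eq_or_eq hyr hPr hyl hPl with rfl | rfl
      · exact hyS hPS
      · rw [hrP, Set.ncard_singleton] at hncard
        omega
    obtain ⟨z, rfl⟩ := hMsurj r hyr
    exact ⟨z, hr⟩
  choose t ht using hT
  have htan : ∀ P, inter S (M (t P)) = {P.1} := fun P => (ht P _).2 rfl
  have hmem : ∀ P, P.1 ∈ M (t P) := fun P =>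
    (htan P ▸ Set.mem_singleton P.1 : P.1 ∈ inter S (M (t P))).2
  have hrow : ∀ P Q, t P 1 = t Q 1 → P = Q := by
    intro P Q hPQ
    have h1 := hMrow P.1 P.2.2 (t P) (t Q 0) (hmem P)
    rw [hPQ, show ![t Q 0, t Q 1] = t Q by ext i; fin_cases i <;> rfl] at h1
    have h2 : P.1 ∈ inter S (M (t Q)) := ⟨P.2.1, h1⟩
    rw [htan Q] at h2
    exact Subtype.ext h2
  have htinj : Function.Injective t := fun P Q h => hrow P Q (congrFun h 1)
  have := Fintype.ofFinite (inter S l)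
  let Z : Finset (Fin 2 → F) := Finset.univ.image t
  have hZcard : Z.card = k := by
    rw [Finset.card_image_of_injective _ htinj, Finset.card_univ, ← Nat.card_eq_fintype_card]
    exact hncard
  have hmemZ : ∀ z, z ∈ Z ↔ ∃ P, t P = z := fun z => by simp [Z]
  refine ⟨M, Z, hMinj, hZcard, ?_, ?_, hMpt, hMline⟩
  · ext r
    constructor
    · rintro ⟨z, hz, rfl⟩
      obtain ⟨P, rfl⟩ := (hmemZ z).1 hz
      exact ⟨P.1, P.2, htan P⟩
    · rintro ⟨P, hP, hr⟩
      exact ⟨t ⟨P, hP⟩, (hmemZ _).2 ⟨_, rfl⟩, ((ht ⟨P, hP⟩ r).1 hr).symm⟩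
  choose g _ hgd hg using hMpt
  have hUcard : (S \ inter S l).ncard = S.ncard - k := by
    rw [Set.ncard_sdiff (fun P hP => hP.1), hncard]
  let U : Finset (Point F) := (Set.toFinite (S \ inter S l)).toFinset
  have hmemU : ∀ Q, Q ∈ U ↔ Q ∈ S ∧ Q ∉ l := fun Q => by
    simp only [U, Set.Finite.mem_toFinset, Set.mem_sdiff, inter, Set.mem_ofPred_eq]
    tauto
  have hU : U.card = S.ncard - k := by
    rw [← hUcard, Set.ncard_eq_toFinset_card]
  rw [← hU, ← hZcard]
  refine spread_of_cover Z ?_ U.card (∏ Q ∈ U, g Q) ?_ ?_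
  · intro z hz w hw hzw
    obtain ⟨P, rfl⟩ := (hmemZ z).1 hz
    obtain ⟨Q, rfl⟩ := (hmemZ w).1 hw
    exact congrArg t (hrow P Q hzw)
  · refine (totalDegree_finsetProd _ _).trans ?_
    simpa using Finset.sum_le_card_nsmul U _ 1 fun Q _ => hgd Q
  · intro z hz x
    obtain ⟨P, rfl⟩ := (hmemZ z).1 hz
    have hPx := hMrow P.1 P.2.2 (t P) x (hmem P)
    rw [map_prod, Finset.prod_ne_zero_iff]
    constructor
    · intro h
      -- A line through `P` other than `l` that avoids `S` off `l` meets `S` only in `P`, so it is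
      -- the unique tangent.
      have htanx : IsTangentAt S P.1 (M ![x, t P 1]) := by
        ext Q
        refine ⟨fun hQ => ?_, fun hQ => ?_⟩
        · by_cases hQl : Q ∈ l
          · exact (eq_or_eq hQl P.2.2 hQ.2 hPx).resolve_right
              fun hl' => hyM ![x, t P 1] (hl' ▸ hyl)
          · exact absurd ((hg Q _).2 hQ.2) (h Q ((hmemU Q).2 ⟨hQ.1, hQl⟩))
        · rw [Set.mem_singleton_iff.1 hQ]
          exact ⟨P.2.1, hPx⟩
      exact congrFun (hMinj ((ht P _).1 htanx)) 0
    · rintro rfl Q hQ hQ0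
      obtain ⟨hQS, hQl⟩ := (hmemU Q).1 hQ
      have h1 := (hg Q _).1 hQ0
      rw [show ![t P 0, t P 1] = t P by ext i; fin_cases i <;> rfl] at h1
      have h2 : Q ∈ inter S (M (t P)) := ⟨hQS, h1⟩
      rw [htan P, Set.mem_singleton_iff] at h2
      exact hQl (h2 ▸ P.2.2)

/-- On a line with at most one point of `S`, the tangents at the points of `S` are concurrent. -/
theorem exists_pencil_of_le_one [Finite F] {S : Set (Point F)} {k : ℕ} {l : Line F}
    (hl : IsSecant k S l) (hk : k < 2) : ∃ G : Point F, tangentsAlong S l ⊆ pencil G := by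
  have hle : (inter S l).encard ≤ 1 := by
    rw [hl]
    exact_mod_cast (by omega : k ≤ 1)
  obtain ⟨P, -⟩ := exists_mem_mem l l
  obtain ⟨G, hG⟩ : ∃ G, ∀ Q ∈ inter S l, Q = G := by
    rcases (inter S l).eq_empty_or_nonempty with h | ⟨G, hG⟩
    · exact ⟨P, by simp [h]⟩
    · exact ⟨G, fun Q hQ => Set.encard_le_one_iff.1 hle Q G hQ hG⟩
  refine ⟨G, ?_⟩
  rintro r ⟨Q, hQ, hr⟩
  rw [← hG Q hQ]
  exact (hr.symm ▸ Set.mem_singleton Q : Q ∈ inter S r).2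

end PG2

/-! ### The theorem -/

open PG2 PlaneCurve MvPolynomial

theorem corollary3p5 {F : Type*} [Field F] [Fintype F] (q : ℕ) (hq : Fintype.card F = q)
    (S : Set (PG2.Point F)) (hS : PG2.IsSemioval S)
    (k : ℕ) (l : PG2.Line F) (hl : PG2.IsSecant k S l) :
    ((S.ncard : ℝ) < (q : ℝ) + 3 * (k : ℝ) / 2 - 2 →
      ∃ G : PG2.Point F, PG2.tangentsAlong S l ⊆ PG2.pencil G) ∧
    ((S.ncard : ℝ) < (q : ℝ) + 5 * (k : ℝ) / 3 - 3 →
      (∃ G₁ G₂ : PG2.Point F, G₁ ≠ G₂ ∧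
        PG2.tangentsAlong S l ⊆ PG2.pencil G₁ ∪ PG2.pencil G₂) ∨
      PG2.IsDualArc k (PG2.tangentsAlong S l)) := by
  classical
  rcases lt_or_ge k 2 with hk | hk
  · obtain ⟨G, hG⟩ := exists_pencil_of_le_one hl hk
    obtain ⟨G', hG'⟩ := exists_ne_point G
    exact ⟨fun _ => ⟨G, hG⟩, fun _ => Or.inl ⟨G, G', hG', hG.trans Set.subset_union_left⟩⟩
  obtain ⟨M, Z, hMinj, hZ, hMZ, hsp, hMpt, hMline⟩ := exists_spread_tangents hS hl hk
  -- Needed, with `1 ≤ q`, so that the inner truncated subtractions in the spread bound are exact.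
  have hkS : k ≤ S.ncard := by
    have h1 : (inter S l).ncard = k := by
      rw [Set.ncard_def, hl]
      rfl
    rw [← h1]
    exact Set.ncard_le_ncard (fun P hP => hP.1) (Set.toFinite S)
  have hq1 : 1 ≤ q := hq ▸ Fintype.card_pos
  rw [hq] at hsp
  rw [← hMZ]
  refine ⟨fun h => ?_, fun h => ?_⟩
  · have h' : 2 * S.ncard + 4 < 2 * q + 3 * k := by
      have : 2 * (S.ncard : ℝ) + 4 < 2 * q + 3 * k := by linarith
      exact_mod_cast this
    obtain ⟨H, H0, Hd, hH⟩ := hsp.onCurve_one (by omega)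
    obtain ⟨G, hG⟩ := hMline H H0 Hd
    refine ⟨G, ?_⟩
    rintro _ ⟨z, hz, rfl⟩
    exact (hG z).1 (hH z hz)
  · have h' : 3 * S.ncard + 9 < 3 * q + 5 * k := by
      have : 3 * (S.ncard : ℝ) + 9 < 3 * q + 5 * k := by linarith
      exact_mod_cast this
    have hconic := hsp.onCurve_two (by omega)
    by_cases harc : ∀ H : MvPolynomial (Fin 2) F, H ≠ 0 → H.totalDegree ≤ 1 → (on Z H).card ≤ 2
    · right
      refine ⟨?_, ?_⟩
      · rw [hMinj.encard_image, Set.encard_coe_eq_coe_finsetCard, hZ]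
      · rintro _ ⟨a, ha, rfl⟩ _ ⟨b, hb, rfl⟩ _ ⟨c, hc, rfl⟩ hab hac hbc ⟨G, hGa, hGb, hGc⟩
        obtain ⟨H, H0, Hd, hH⟩ := hMpt G
        have h3 : ({a, b, c} : Finset (Fin 2 → F)).card = 3 :=
          Finset.card_eq_three.2 ⟨a, b, c, fun h => hab (h ▸ rfl), fun h => hac (h ▸ rfl),
            fun h => hbc (h ▸ rfl), rfl⟩
        have hsub : ({a, b, c} : Finset (Fin 2 → F)) ⊆ on Z H := by
          intro z hz
          rw [Finset.mem_insert, Finset.mem_insert, Finset.mem_singleton] at hz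
          rcases hz with rfl | rfl | rfl
          · exact mem_on.2 ⟨ha, (hH _).2 hGa⟩
          · exact mem_on.2 ⟨hb, (hH _).2 hGb⟩
          · exact mem_on.2 ⟨hc, (hH _).2 hGc⟩
        have := (Finset.card_le_card hsub).trans (harc H H0 Hd)
        omega
    · left
      push Not at harc
      obtain ⟨H, H0, Hd, h3⟩ := harc
      obtain ⟨H', H0', Hd', hH'⟩ := hconic.two_lines H0 Hd h3
      obtain ⟨G, hG⟩ := hMline H H0 Hd
      obtain ⟨G', hG'⟩ := hMline H' H0' Hd'
      have hcov : M '' Z ⊆ pencil G ∪ pencil G' := by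
        rintro _ ⟨z, hz, rfl⟩
        by_cases hzH : eval z H = 0
        · exact Or.inl ((hG z).1 hzH)
        · exact Or.inr ((hG' z).1 (hH' z (mem_off.2 ⟨hz, hzH⟩)))
      -- The two carriers must be distinct; if they coincide, any other point serves as the second.
      rcases eq_or_ne G G' with rfl | hne
      · obtain ⟨G'', hG''⟩ := exists_ne_point G
        rw [Set.union_self] at hcov
        exact ⟨G, G'', hG'', hcov.trans Set.subset_union_left⟩
      · exact ⟨G, G', hne, hcov⟩
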